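/- Let $\mathbb{H}(\mathbb{C})$ be the algebra of quaternions with complex coefficients, with units $1,I,J,K$ and complex imaginary unit $i$, and let $$e_1=\tfrac12(1+iI),\quad e_2=\tfrac12(1-iI),\quad e_3=\tfrac12(iJ-K),\quad e_4=\tfrac12(iJ+K)$$ be its basis over $\mathbb{C}$, with the norm $\|\sum_{k=1}^4 a_ke_k\|=\sqrt{\sum_{k=1}^4|a_k|^2}$. Let $f_1,f_2:\mathbb{H}(\mathbb{C})\to\mathbb{C}$ be the $\mathbb{C}$-linear functionals with $f_1(e_1)=f_1(e_3)=1$, $f_1(e_2)=f_1(e_4)=0$ and $f_2(e_2)=f_2(e_4)=1$, $f_2(e_1)=f_2(e_3)=0$. Let $a_1,a_2,b_1,b_2\in\mathbb{C}$ be such that $i_1=1$, $i_2=a_1e_1+a_2e_2$, $i_3=b_1e_1+b_2e_2$ are linearly independent over $\mathbb{R}$, and let $E_3=\{xi_1+yi_2+zi_3:x,y,z\in\mathbb{R}\}$. For a domain (non-empty connected open set) $\Omega\subset\mathbb{R}^3$ put $\Omega_\zeta=\{xi_1+yi_2+zi_3:(x,y,z)\in\Omega\}$. For $\zeta=xi_1+yi_2+zi_3$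 write $\xi_k=f_k(\zeta)=x+ya_k+zb_k$, and put $D_k=f_k(\Omega_\zeta)$, $k=1,2$. Let $L_k\subset\mathbb{R}^3$ be given by $$x+y\,\mathrm{Re}\,a_k+z\,\mathrm{Re}\,b_k=0,\qquad y\,\mathrm{Im}\,a_k+z\,\mathrm{Im}\,b_k=0 .$$ The set $\Omega$ is called convex in the direction of a line $L$ if it contains every segment that is parallel to $L$ and joins two points of $\Omega$. A continuous map $\Phi:\Omega_\zeta\to\mathbb{H}(\mathbb{C})$ is called right-$G$-monogenic (resp. left-$G$-monogenic) in $\Omega_\zeta$ if for every $\zeta\in\Omega_\zeta$ there is an element $\Phi'(\zeta)\in\mathbb{H}(\mathbb{C})$, called the right (resp. left) Gateaux derivative, such that for all $h\in E_3$ $$\lim_{\varepsilon\to0+0}\big(\Phi(\zeta+\varepsilon h)-\Phi(\zeta)\big)\varepsilon^{-1}=h\,\Phi'(\zeta)\qquad\text{(resp. }=\Phi'(\zeta)\,h\text{)}.$$ **Theorem.** Let $\Omega$ be convex in the directions of $L_1$ and $L_2$, let $f_1(E_3)=f_2(E_3)=\mathbb{C}$, let $\Phi:\Omega_\zeta\to\mathbb{H}(\mathbb{C})$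 be right-$G$-monogenic and $\widehat\Phi:\Omega_\zeta\to\mathbb{H}(\mathbb{C})$ left-$G$-monogenic in $\Omega_\zeta$. Then the Gateaux derivatives of all orders (right ones for $\Phi$, left ones for $\widehat\Phi$) exist in $\Omega_\zeta$ and are right-$G$-monogenic, respectively left-$G$-monogenic, in $\Omega_\zeta$. Moreover: (a) there are functions $F_1,F_3$ analytic in $D_1$ and $F_2,F_4$ analytic in $D_2$ such that for all $\zeta\in\Omega_\zeta$ $$\Phi(\zeta)=F_1(\xi_1)e_1+F_2(\xi_2)e_2+F_3(\xi_1)e_3+F_4(\xi_2)e_4,$$ $$\Phi'(\zeta)=F_1'(\xi_1)e_1+F_2'(\xi_2)e_2+F_3'(\xi_1)e_3+F_4'(\xi_2)e_4;$$ (b) there are functions $F_1,F_4$ analytic in $D_1$ and $F_2,F_3$ analytic in $D_2$ such that for all $\zeta\in\Omega_\zeta$ $$\widehat\Phi(\zeta)=F_1(\xi_1)e_1+F_2(\xi_2)e_2+F_3(\xi_2)e_3+F_4(\xi_1)e_4,$$ $$\widehat\Phi'(\zeta)=F_1'(\xi_1)e_1+F_2'(\xi_2)e_2+F_3'(\xi_2)e_3+F_4'(\xi_1)e_4.$$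 -/

import Mathlib

open Filter Topology Quaternion

noncomputable section

namespace HC

/-- The complex quaternion algebra `ℍ(ℂ)`, i.e. Hamilton's quaternions with complex
coefficients; `⟨w, x, y, z⟩` is `w + x I + y J + z K`. -/
abbrev Biquat : Type := Quaternion ℂ

/-- `e₁ = (1 + iI)/2`. -/
def e₁ : Biquat := ⟨1 / 2, Complex.I / 2, 0, 0⟩
/-- `e₂ = (1 - iI)/2`. -/
def e₂ : Biquat := ⟨1 / 2, -Complex.I / 2, 0, 0⟩
/-- `e₃ = (iJ - K)/2`. -/
def e₃ : Biquat := ⟨0, 0, Complex.I / 2, -1 / 2⟩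
/-- `e₄ = (iJ + K)/2`. -/
def e₄ : Biquat := ⟨0, 0, Complex.I / 2, 1 / 2⟩

@[simp] theorem e₁_re : e₁.re = 1 / 2 := rfl
@[simp] theorem e₁_imI : e₁.imI = Complex.I / 2 := rfl
@[simp] theorem e₁_imJ : e₁.imJ = 0 := rfl
@[simp] theorem e₁_imK : e₁.imK = 0 := rfl
@[simp] theorem e₂_re : e₂.re = 1 / 2 := rfl
@[simp] theorem e₂_imI : e₂.imI = -Complex.I / 2 := rfl
@[simp] theorem e₂_imJ : e₂.imJ = 0 := rfl
@[simp] theorem e₂_imK : e₂.imK = 0 := rfl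
@[simp] theorem e₃_re : e₃.re = 0 := rfl
@[simp] theorem e₃_imI : e₃.imI = 0 := rfl
@[simp] theorem e₃_imJ : e₃.imJ = Complex.I / 2 := rfl
@[simp] theorem e₃_imK : e₃.imK = -1 / 2 := rfl
@[simp] theorem e₄_re : e₄.re = 0 := rfl
@[simp] theorem e₄_imI : e₄.imI = 0 := rfl
@[simp] theorem e₄_imJ : e₄.imJ = Complex.I / 2 := rfl
@[simp] theorem e₄_imK : e₄.imK = 1 / 2 := rfl

/-- The coordinates of a complex quaternion with respect to `e₁, e₂, e₃, e₄`
(see `coords_spec` and `coords_sum`). -/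
def coords : Biquat →ₗ[ℂ] (Fin 4 → ℂ) where
  toFun a := ![a.re - Complex.I * a.imI, a.re + Complex.I * a.imI,
    -(Complex.I * a.imJ) - a.imK, -(Complex.I * a.imJ) + a.imK]
  map_add' a b := by
    ext k; fin_cases k <;> simp <;> ring
  map_smul' c a := by
    ext k; fin_cases k <;> simp <;> ring

theorem coords_spec (a : Biquat) :
    a = coords a 0 • e₁ + coords a 1 • e₂ + coords a 2 • e₃ + coords a 3 • e₄ := by
  have hI := Complex.I_mul_I
  ext <;> simp [coords] <;> grind

theorem coords_sum (c : Fin 4 → ℂ) :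
    coords (c 0 • e₁ + c 1 • e₂ + c 2 • e₃ + c 3 • e₄) = c := by
  have hI := Complex.I_mul_I
  ext k; fin_cases k <;> simp [coords] <;> grind

theorem coords_injective : Function.Injective coords := by
  intro a b h
  rw [coords_spec a, coords_spec b, h]

/-- The coordinates with respect to `e₁, e₂, e₃, e₄` as a vector of the Euclidean space `ℂ⁴`. -/
def coordsL2 : Biquat →+ EuclideanSpace ℂ (Fin 4) where
  toFun a := WithLp.toLp 2 (coords a)
  map_zero' := by simp
  map_add' a b := by simp

/-- The norm `‖a‖ = √(|a₁|² + |a₂|² + |a₃|² + |a₄|²)` for `a = a₁e₁ + a₂e₂ + a₃e₃ + a₄e₄`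
(see `norm_eq`), with the topology it induces. -/
instance instNormedAddCommGroupBiquat : NormedAddCommGroup Biquat :=
  NormedAddCommGroup.induced Biquat (EuclideanSpace ℂ (Fin 4)) coordsL2
    (fun a b h => coords_injective (by
      have h' := congrArg WithLp.ofLp h
      simpa [coordsL2] using h'))

theorem norm_eq (a : Biquat) : ‖a‖ = Real.sqrt (∑ k, ‖coords a k‖ ^ 2) := by
  change ‖coordsL2 a‖ = _
  rw [EuclideanSpace.norm_eq]
  rfl

/-- The linear functional with `f₁(e₁) = f₁(e₃) = 1`, `f₁(e₂) = f₁(e₄) = 0`. -/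
def f₁ : Biquat →ₗ[ℂ] ℂ := (LinearMap.proj (R := ℂ) (φ := fun _ : Fin 4 => ℂ) 0 + LinearMap.proj 2) ∘ₗ coords
/-- The linear functional with `f₂(e₂) = f₂(e₄) = 1`, `f₂(e₁) = f₂(e₃) = 0`. -/
def f₂ : Biquat →ₗ[ℂ] ℂ := (LinearMap.proj (R := ℂ) (φ := fun _ : Fin 4 => ℂ) 1 + LinearMap.proj 3) ∘ₗ coords

theorem f₁_apply (a : Biquat) : f₁ a = coords a 0 + coords a 2 := rfl
theorem f₂_apply (a : Biquat) : f₂ a = coords a 1 + coords a 3 := rfl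

/-- The triple `i₁ = 1`, `i₂ = a₁e₁ + a₂e₂`, `i₃ = b₁e₁ + b₂e₂`. -/
def frame (a₁ a₂ b₁ b₂ : ℂ) : Fin 3 → Biquat :=
  ![1, a₁ • e₁ + a₂ • e₂, b₁ • e₁ + b₂ • e₂]

/-- The real linear span `E₃` of `i₁, i₂, i₃`. -/
def E₃ (a₁ a₂ b₁ b₂ : ℂ) : Submodule ℝ Biquat :=
  Submodule.span ℝ (Set.range (frame a₁ a₂ b₁ b₂))

/-- `Ω_ζ = {x i₁ + y i₂ + z i₃ : (x, y, z) ∈ Ω}`. -/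
def domainζ (a₁ a₂ b₁ b₂ : ℂ) (Ω : Set (Fin 3 → ℝ)) : Set Biquat :=
  (fun p : Fin 3 → ℝ => ∑ k, p k • frame a₁ a₂ b₁ b₂ k) '' Ω

/-- The line `x + y Re a + z Re b = 0`, `y Im a + z Im b = 0` in `ℝ³`
(it is `L₁` for `a = a₁, b = b₁` and `L₂` for `a = a₂, b = b₂`). -/
def line (a b : ℂ) : Submodule ℝ (Fin 3 → ℝ) where
  carrier := {p | p 0 + p 1 * a.re + p 2 * b.re = 0 ∧ p 1 * a.im + p 2 * b.im = 0}
  zero_mem' := by simp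
  add_mem' := by
    rintro p q ⟨hp, hp'⟩ ⟨hq, hq'⟩
    simp only [Set.mem_ofPred_eq, Pi.add_apply]
    exact ⟨by linear_combination hp + hq, by linear_combination hp' + hq'⟩
  smul_mem' := by
    rintro c p ⟨hp, hp'⟩
    simp only [Set.mem_ofPred_eq, Pi.smul_apply, smul_eq_mul]
    exact ⟨by linear_combination c * hp, by linear_combination c * hp'⟩

/-- `Ω` is convex in the direction of the line `L` (through the origin): it contains every segment
that is parallel to `L` and joins two of its points. -/
def ConvexInDirection (L : Submodule ℝ (Fin 3 → ℝ)) (Ω : Set (Fin 3 → ℝ)) : Prop :=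
  ∀ p ∈ Ω, ∀ q ∈ Ω, q - p ∈ L → segment ℝ p q ⊆ Ω

/-- `d` is the right Gateaux derivative of `Φ` at `ζ` (with respect to the directions in `E`). -/
def HasRightGDerivAt (E : Submodule ℝ Biquat) (Φ : Biquat → Biquat) (d ζ : Biquat) : Prop :=
  ∀ h ∈ E, Tendsto (fun ε : ℝ => ε⁻¹ • (Φ (ζ + ε • h) - Φ ζ)) (𝓝[>] 0) (𝓝 (h * d))

/-- `d` is the left Gateaux derivative of `Φ` at `ζ` (with respect to the directions in `E`). -/
def HasLeftGDerivAt (E : Submodule ℝ Biquat) (Φ : Biquat → Biquat) (d ζ : Biquat) : Prop :=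
  ∀ h ∈ E, Tendsto (fun ε : ℝ => ε⁻¹ • (Φ (ζ + ε • h) - Φ ζ)) (𝓝[>] 0) (𝓝 (d * h))

theorem HasRightGDerivAt.unique {E : Submodule ℝ Biquat} (hE : (1 : Biquat) ∈ E)
    {Φ : Biquat → Biquat} {d d' ζ : Biquat} (hd : HasRightGDerivAt E Φ d ζ)
    (hd' : HasRightGDerivAt E Φ d' ζ) : d = d' := by
  simpa using tendsto_nhds_unique (hd 1 hE) (hd' 1 hE)

theorem HasLeftGDerivAt.unique {E : Submodule ℝ Biquat} (hE : (1 : Biquat) ∈ E)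
    {Φ : Biquat → Biquat} {d d' ζ : Biquat} (hd : HasLeftGDerivAt E Φ d ζ)
    (hd' : HasLeftGDerivAt E Φ d' ζ) : d = d' := by
  simpa using tendsto_nhds_unique (hd 1 hE) (hd' 1 hE)

theorem one_mem_E₃ (a₁ a₂ b₁ b₂ : ℂ) : (1 : Biquat) ∈ E₃ a₁ a₂ b₁ b₂ :=
  Submodule.subset_span ⟨0, rfl⟩

/-- `Φ` is right-G-monogenic in `U`: continuous, with a right Gateaux derivative at every point. -/
def RightGMonogenicOn (E : Submodule ℝ Biquat) (Φ : Biquat → Biquat) (U : Set Biquat) : Prop :=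
  ContinuousOn Φ U ∧ ∀ ζ ∈ U, ∃ d, HasRightGDerivAt E Φ d ζ

/-- `Φ` is left-G-monogenic in `U`: continuous, with a left Gateaux derivative at every point. -/
def LeftGMonogenicOn (E : Submodule ℝ Biquat) (Φ : Biquat → Biquat) (U : Set Biquat) : Prop :=
  ContinuousOn Φ U ∧ ∀ ζ ∈ U, ∃ d, HasLeftGDerivAt E Φ d ζ

open Classical in
/-- The right Gateaux derivative `Φ'(ζ)` (zero where it does not exist). -/
def rightGDeriv (E : Submodule ℝ Biquat) (Φ : Biquat → Biquat) (ζ : Biquat) : Biquat :=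
  if h : ∃ d, HasRightGDerivAt E Φ d ζ then h.choose else 0

open Classical in
/-- The left Gateaux derivative `Φ'(ζ)` (zero where it does not exist). -/
def leftGDeriv (E : Submodule ℝ Biquat) (Φ : Biquat → Biquat) (ζ : Biquat) : Biquat :=
  if h : ∃ d, HasLeftGDerivAt E Φ d ζ then h.choose else 0

end HC

end

/-! In the basis `e₁, e₂, e₃, e₄` the algebra is that of 2 × 2 matrices: `e₁, e₃` span the first
row, `e₄, e₂` the second. Elements of `E₃` are the diagonal matrices with entries f₁(h), f₂(h).
Multiplying by h on the left scales rows, on the right scales columns, so monogenicity decouples: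
each coordinate u has one-sided derivative l(h)·d in every direction h, with l = f₁ or f₂ on `E₃`.
This vanishes along the fibres of l, which are parallel to L₁ or L₂; convexity makes u constant on
them, and u descends to a continuous F on the open set l(Ω) with one-sided directional derivatives
w·d.

It remains to show that such an F is holomorphic (`analyticOnNhd_of_gateaux`), although nothing is
assumed about uniformity in w. Let E be the set where F is not analytic. By Baire, on a relatively
open piece of E the difference quotients in the four axis directions are uniformly bounded. Joining
two points of E by a horizontal and a vertical segment gives a Lipschitz bound between them. A
Phragmén–Lindelöf argument (`norm_sub_le_of_le_on_closed_of_le_on_ray`) carries this bound to points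
off E, so F is Lipschitz near a point of E. A Lipschitz function with linear Gateaux derivative is
Fréchet differentiable; here the derivative is complex linear, so F is analytic at that point of E,
a contradiction.

Conversely, analytic coordinates always give a monogenic function whose derivative has coordinates
F', and iteration handles all orders. -/

/-! ### Phragmén–Lindelöf for difference quotients. -/

/-- Every complex number has a fourth root in the closed sector `|arg v| ≤ π / 4`. -/
theorem Complex.exists_pow_four_eq_abs_im_le_re (u : ℂ) : ∃ v : ℂ, v ^ 4 = u ∧ |v.im| ≤ v.re := by
  obtain ⟨v, hv⟩ : ∃ v : ℂ, v ^ 4 = u := IsAlgClosed.exists_pow_nat_eq u (by norm_num)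
  have hI : Complex.I ^ 4 = 1 := Complex.I_pow_four
  -- One of the rotations of `v` by a power of `I` lies in the sector.
  rcases le_total |v.im| |v.re| with h | h
  · rcases abs_cases v.re with ⟨h1, h2⟩ | ⟨h1, h2⟩
    · exact ⟨v, hv, by linarith⟩
    · exact ⟨-v, by rw [← hv]; ring, by simpa using by linarith⟩
  · rcases abs_cases v.im with ⟨h1, h2⟩ | ⟨h1, h2⟩
    · exact ⟨-Complex.I * v, by rw [← hv, mul_pow, neg_pow, hI]; ring, by simpa using by linarith⟩
    · exact ⟨Complex.I * v, by rw [← hv, mul_pow, hI]; ring, by simpa using by linarith⟩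

/-- In the sector Re(1/v) ≥ 1/(2|v|), and e^y ≥ y⁵/5!. The fifth power beats the a priori growth
|v|⁻⁴ of the difference quotient in the variable v, with one factor |v| to spare. -/
theorem Complex.norm_exp_neg_div_le {ε : ℝ} (hε : 0 < ε) {v : ℂ} (hv : |v.im| ≤ v.re) (hv0 : v ≠ 0) :
    ‖Complex.exp (-(ε / v))‖ ≤ 1 ∧
      ‖Complex.exp (-(ε / v))‖ ≤ 120 * (2 / ε) ^ 5 * ‖v‖ ^ 5 := by
  have hn : 0 < ‖v‖ := norm_pos_iff.2 hv0
  have h2 : ‖v‖ ≤ 2 * v.re := by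
    have := Complex.norm_le_abs_re_add_abs_im v
    have h3 : |v.re| = v.re := abs_of_nonneg ((abs_nonneg _).trans hv)
    linarith
  have hre : (ε / v : ℂ).re = ε * v.re / ‖v‖ ^ 2 := by
    rw [Complex.div_re, Complex.normSq_eq_norm_sq]; simp
  have hy : ε / (2 * ‖v‖) ≤ (ε / v : ℂ).re := by
    rw [hre, div_le_div_iff₀ (by positivity) (by positivity)]
    nlinarith [mul_le_mul_of_nonneg_left h2 (mul_pos hε hn).le]
  have hy0 : 0 < ε / (2 * ‖v‖) := by positivity
  rw [Complex.norm_exp, Complex.neg_re]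
  refine ⟨Real.exp_le_one_iff.2 (by linarith), ?_⟩
  calc Real.exp (-(ε / v : ℂ).re) ≤ Real.exp (-(ε / (2 * ‖v‖))) := Real.exp_le_exp.2 (by linarith)
    _ = (Real.exp (ε / (2 * ‖v‖)))⁻¹ := Real.exp_neg _
    _ ≤ ((ε / (2 * ‖v‖)) ^ 5 / (Nat.factorial 5 : ℝ))⁻¹ :=
        inv_anti₀ (by positivity) (Real.pow_div_factorial_le_exp _ hy0.le 5)
    _ = 120 * (2 / ε) ^ 5 * ‖v‖ ^ 5 := by
        simp [Nat.factorial]; field_simp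

open Set Metric in
/-- A Phragmén–Lindelöf principle for the difference quotient `(F w - F z) / (w - z)`: if it is
bounded on a closed set `E` off which `F` is holomorphic, on a ray from `z`, and on a circle around
`z`, then it is bounded inside the circle. -/
theorem norm_sub_le_of_le_on_closed_of_le_on_ray {F : ℂ → ℂ} {z : ℂ} {r C : ℝ} (hr : 0 < r)
    {E : Set ℂ} (hE : IsClosed E) (hF : ContinuousOn F (closedBall z r))
    (hd : ∀ w ∈ closedBall z r, w ∉ E → DifferentiableAt ℂ F w)
    (hEC : ∀ w ∈ closedBall z r, w ∈ E → ‖F w - F z‖ ≤ C * ‖w - z‖)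
    (hray : ∀ t : ℝ, 0 ≤ t → t ≤ r → ‖F (z - t) - F z‖ ≤ C * t)
    (hsphere : ∀ w ∈ sphere z r, ‖F w - F z‖ ≤ C * r) :
    ∀ w ∈ closedBall z r, ‖F w - F z‖ ≤ C * ‖w - z‖ := by
  have hC : 0 ≤ C := by
    have := (norm_nonneg _).trans (hsphere (z + r) (by simp [hr.le]))
    nlinarith
  obtain ⟨M, hM⟩ := (isCompact_closedBall z r).exists_bound_of_continuousOn
    (hF.sub (continuousOn_const (c := F z)))
  have hM0 : 0 ≤ M := (norm_nonneg _).trans (hM z (mem_closedBall_self hr.le))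
  -- The map v ↦ z + v⁴ sends the sector onto the disc, both edges going to the ray z - t. A square
  -- root would also open the slit, but onto a half-plane, where Re(1/v) is not comparable to 1/|v|.
  set S : Set ℂ := {v | |v.im| ≤ v.re ∧ ‖v‖ ^ 4 ≤ r} with hS
  set V : Set ℂ := {v | |v.im| < v.re ∧ ‖v‖ ^ 4 < r ∧ z + v ^ 4 ∉ E} with hV
  have hSc : IsClosed S := by
    apply IsClosed.inter
    · exact isClosed_le (f := fun v : ℂ => |v.im|) (g := fun v => v.re) (by fun_prop) (by fun_prop)
    · exact isClosed_le (f := fun v : ℂ => ‖v‖ ^ 4) (g := fun _ => r) (by fun_prop) (by fun_prop)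
  have hVo : IsOpen V := by
    apply IsOpen.inter
    · exact isOpen_lt (f := fun v : ℂ => |v.im|) (g := fun v => v.re) (by fun_prop) (by fun_prop)
    apply IsOpen.inter
    · exact isOpen_lt (f := fun v : ℂ => ‖v‖ ^ 4) (g := fun _ => r) (by fun_prop) (by fun_prop)
    · exact hE.isOpen_compl.preimage (by fun_prop : Continuous fun v : ℂ => z + v ^ 4)
  have hVS : closure V ⊆ S :=
    closure_minimal (fun v hv => ⟨hv.1.le, hv.2.1.le⟩) hSc
  have hmaps : MapsTo (fun v : ℂ => z + v ^ 4) S (closedBall z r) := fun v hv => by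
    simpa using hv.2
  have hVb : Bornology.IsBounded V := by
    refine (isBounded_closedBall (x := (0 : ℂ)) (r := max r 1)).subset fun v hv => ?_
    rw [mem_closedBall_zero_iff]
    by_contra! h
    have h1 : 1 < ‖v‖ := (le_max_right _ _).trans_lt h
    have h2 : r < ‖v‖ := (le_max_left _ _).trans_lt h
    have h3 := le_self_pow₀ h1.le (by norm_num : (4 : ℕ) ≠ 0)
    have := hv.2.1
    linarith
  -- The difference quotient, damped at the vertex so that the maximum principle applies; ε tends to
  -- 0 at the end.
  set f : ℝ → ℂ → ℂ := fun ε v => (F (z + v ^ 4) - F z) / v ^ 4 * Complex.exp (-(ε / v)) with hf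
  have hfC : ∀ ε, 0 < ε → DiffContOnCl ℂ (f ε) V := by
    intro ε hε
    have h0V : ∀ v ∈ V, v ≠ 0 := by
      rintro v hv rfl
      simpa using hv.1
    refine ⟨fun v hv => ?_, fun v hv => ?_⟩
    · have hv0 := h0V v hv
      have h1 : DifferentiableAt ℂ F (z + v ^ 4) :=
        hd _ (hmaps (hVS (subset_closure hv))) hv.2.2
      have h2 : DifferentiableAt ℂ (fun v : ℂ => F (z + v ^ 4)) v :=
        DifferentiableAt.comp (f := fun v : ℂ => z + v ^ 4) v h1 (by fun_prop)
      refine DifferentiableAt.differentiableWithinAt ?_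
      refine ((h2.sub_const _).div (by fun_prop) (by simpa using hv0)).mul ?_
      exact (((differentiableAt_const _).div differentiableAt_id hv0).neg).cexp
    · by_cases hv0 : v = 0
      · subst hv0
        -- Division by zero gives 0, which is also the limit at the vertex.
        have hf0 : f ε 0 = 0 := by simp [hf]
        rw [ContinuousWithinAt, hf0]
        refine squeeze_zero_norm' (a := fun v => M * (120 * (2 / ε) ^ 5) * ‖v‖) ?_ ?_
        · filter_upwards [self_mem_nhdsWithin] with v hv
          by_cases hv0 : v = 0
          · simp [hv0, hf0]
          have hn : 0 < ‖v‖ := norm_pos_iff.2 hv0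
          have h1 := hM _ (hmaps (hVS hv))
          have h2 := (Complex.norm_exp_neg_div_le hε (hVS hv).1 hv0).2
          calc ‖f ε v‖ = ‖F (z + v ^ 4) - F z‖ / ‖v‖ ^ 4 * ‖Complex.exp (-(ε / v))‖ := by
                simp [hf]
            _ ≤ M / ‖v‖ ^ 4 * (120 * (2 / ε) ^ 5 * ‖v‖ ^ 5) := by
                gcongr
                exact h1
            _ = M * (120 * (2 / ε) ^ 5) * ‖v‖ := by field_simp
        · have : Continuous fun v : ℂ => M * (120 * (2 / ε) ^ 5) * ‖v‖ := by fun_prop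
          simpa using (this.tendsto 0).mono_left nhdsWithin_le_nhds
      · have h1 : ContinuousWithinAt (fun v : ℂ => F (z + v ^ 4)) (closure V) v :=
          ContinuousWithinAt.comp (t := closedBall z r) (f := fun v : ℂ => z + v ^ 4)
            (hF _ (hmaps (hVS hv))) (by fun_prop) (fun v hv => hmaps (hVS hv))
        refine ((h1.sub continuousWithinAt_const).div (by fun_prop) (by simpa using hv0)).mul ?_
        exact ((continuousWithinAt_const.div continuousWithinAt_id hv0).neg).cexp
  have hbd : ∀ v ∈ S, v ∉ V → ‖F (z + v ^ 4) - F z‖ ≤ C * ‖v ^ 4‖ := by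
    intro v hvS hvV
    by_cases h1 : z + v ^ 4 ∈ E
    · simpa using hEC _ (hmaps hvS) h1
    by_cases h2 : ‖v‖ ^ 4 < r
    · have h3 : |v.im| = v.re :=
        le_antisymm hvS.1 (not_lt.1 fun h => hvV ⟨h, h2, h1⟩)
      have h4 : v ^ 4 = -((‖v‖ ^ 4 : ℝ) : ℂ) := by
        have h5 : v.im ^ 2 = v.re ^ 2 := by rw [← h3, sq_abs]
        have h6 : ‖v‖ ^ 4 = 4 * v.re ^ 4 := by
          have : ‖v‖ ^ 2 = 2 * v.re ^ 2 := by
            rw [← Complex.normSq_eq_norm_sq, Complex.normSq_apply]; linarith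
          calc ‖v‖ ^ 4 = (‖v‖ ^ 2) ^ 2 := by ring
            _ = _ := by rw [this]; ring
        have h7 : v ^ 2 = ((2 * v.re * v.im : ℝ) : ℂ) * Complex.I := by
          apply Complex.ext
          · simp [sq]; linarith
          · simp [sq]; ring
        rw [h6]
        calc v ^ 4 = (v ^ 2) ^ 2 := by ring
          _ = -((4 * v.re ^ 2 * v.im ^ 2 : ℝ) : ℂ) := by
            rw [h7, mul_pow, Complex.I_sq]; push_cast; ring
          _ = _ := by rw [h5]; congr 2; ring
      have := hray (‖v‖ ^ 4) (by positivity) h2.le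
      rw [h4, norm_neg, Complex.norm_real, Real.norm_of_nonneg (by positivity)]
      simpa [sub_eq_add_neg] using this
    · have h3 : ‖v‖ ^ 4 = r := le_antisymm hvS.2 (not_lt.1 h2)
      rw [norm_pow, h3]
      exact hsphere _ (by simpa using h3)
  have key : ∀ v ∈ S, ‖F (z + v ^ 4) - F z‖ ≤ C * ‖v ^ 4‖ := by
    intro v hvS
    by_cases hvV : v ∈ V
    swap
    · exact hbd v hvS hvV
    have hv0 : v ≠ 0 := by
      rintro rfl
      simpa using hvV.1
    have h1 : ∀ ε : ℝ, 0 < ε → ‖f ε v‖ ≤ C := by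
      intro ε hε
      refine Complex.norm_le_of_forall_mem_frontier_norm_le hVb (hfC ε hε) (fun y hy => ?_)
        (subset_closure hvV)
      rw [hVo.frontier_eq] at hy
      by_cases hy0 : y = 0
      · simpa [hf, hy0] using hC
      have h2 := hbd y (hVS hy.1) hy.2
      have h3 := (Complex.norm_exp_neg_div_le hε (hVS hy.1).1 hy0).1
      have hn : 0 < ‖y ^ 4‖ := norm_pos_iff.2 (pow_ne_zero _ hy0)
      calc ‖f ε y‖ = ‖F (z + y ^ 4) - F z‖ / ‖y ^ 4‖ * ‖Complex.exp (-(ε / y))‖ := by simp [hf]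
        _ ≤ C * 1 := by
          refine mul_le_mul ?_ h3 (norm_nonneg _) hC
          rwa [div_le_iff₀ hn]
        _ = C := mul_one C
    have h2 : Tendsto (fun ε : ℝ => ‖f ε v‖) (𝓝[>] 0) (𝓝 ‖f 0 v‖) := by
      have : Continuous fun ε : ℝ => ‖f ε v‖ := by
        simp only [hf]; fun_prop
      exact (this.tendsto 0).mono_left nhdsWithin_le_nhds
    have h3 : ‖f 0 v‖ ≤ C := le_of_tendsto h2 (by
      filter_upwards [self_mem_nhdsWithin] with ε hε using h1 ε hε)
    have hn : 0 < ‖v ^ 4‖ := norm_pos_iff.2 (pow_ne_zero _ hv0)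
    rw [← div_le_iff₀ hn, ← norm_div]
    simpa [hf] using h3
  intro w hw
  obtain ⟨v, hv, hv'⟩ := Complex.exists_pow_four_eq_abs_im_le_re (w - z)
  have h := key v ⟨hv', by rw [← norm_pow, hv]; simpa [dist_eq_norm] using hw⟩
  simpa [hv] using h

/-! ### From axis estimates on E to a local Lipschitz bound. -/

open Set Metric in
/-- A continuous function that is holomorphic off a closed set `E` and satisfies a uniform Lipschitz
estimate from points of `E` in the horizontal and vertical directions is Lipschitz near every point
of `E`. -/
theorem exists_lipschitzOnWith_ball_of_le_on_axes {F : ℂ → ℂ} {E : Set ℂ} (hE : IsClosed E) {a : ℂ}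
    (ha : a ∈ E) {ρ N : ℝ} (hρ : 0 < ρ) (hF : ContinuousOn F (closedBall a ρ))
    (hd : ∀ w ∈ ball a ρ, w ∉ E → DifferentiableAt ℂ F w)
    (hN : ∀ z ∈ E, z ∈ ball a ρ → ∀ w ∈ ball a ρ, (w - z).re = 0 ∨ (w - z).im = 0 →
      ‖F w - F z‖ ≤ N * ‖w - z‖) :
    ∃ s > 0, ∃ K, LipschitzOnWith K F (ball a s) := by
  obtain ⟨M, hM⟩ := (isCompact_closedBall a ρ).exists_bound_of_continuousOn hF
  have hN0 : 0 ≤ N := by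
    have h1 : a + (ρ / 2 : ℝ) ∈ ball a ρ := by
      rw [mem_ball, dist_eq_norm, add_sub_cancel_left, Complex.norm_real, Real.norm_eq_abs,
        abs_of_pos] <;> linarith
    have h2 := (norm_nonneg _).trans (hN a ha (mem_ball_self hρ) _ h1 (by simp))
    rw [add_sub_cancel_left, Complex.norm_real, Real.norm_eq_abs, abs_of_pos (by linarith)] at h2
    nlinarith
  -- `2 * N` pays for the two legs between points of `E`; the other term pays for the circle of
  -- radius `ρ / 4`.
  set C : ℝ := max (2 * N) (2 * M / (ρ / 4)) with hC
  have hCN : 2 * N ≤ C := le_max_left _ _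
  have hCM : 2 * M ≤ C * (ρ / 4) := (div_le_iff₀ (by positivity)).1 (le_max_right _ _)
  have hC0 : 0 ≤ C := by linarith
  have key : ∀ z ∈ E, z ∈ ball a (ρ / 4) → ∀ w ∈ closedBall z (ρ / 4),
      dist (F w) (F z) ≤ C * dist w z := by
    intro z hzE hz
    have hsub : closedBall z (ρ / 4) ⊆ ball a (ρ / 2) := by
      apply closedBall_subset_ball'
      have := mem_ball.1 hz
      linarith
    have hsub' : closedBall z (ρ / 4) ⊆ ball a ρ :=
      hsub.trans (ball_subset_ball (by linarith))
    have hzz : z ∈ closedBall z (ρ / 4) := mem_closedBall_self (by linarith)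
    simp only [dist_eq_norm]
    refine norm_sub_le_of_le_on_closed_of_le_on_ray (by positivity) hE
      (hF.mono (hsub'.trans ball_subset_closedBall)) (fun w hw => hd w (hsub' hw)) ?_ ?_ ?_
    · intro w hw hwE
      have hp : ∀ u ∈ ball a (ρ / 2), |u.re - a.re| < ρ / 2 ∧ |u.im - a.im| < ρ / 2 := by
        intro u hu
        rw [mem_ball, dist_eq_norm] at hu
        exact ⟨(Complex.abs_re_le_norm (u - a)).trans_lt hu,
          (Complex.abs_im_le_norm (u - a)).trans_lt hu⟩
      -- The corner `p` need not lie in `E`: each leg is estimated from its endpoint in `E`.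
      set p : ℂ := ⟨w.re, z.im⟩ with hpdef
      have hpb : p ∈ ball a ρ := by
        rw [mem_ball, dist_eq_norm]
        have h1 := (hp w (hsub hw)).1
        have h2 := (hp z (hsub hzz)).2
        have h3 := Complex.norm_le_abs_re_add_abs_im (p - a)
        simp only [Complex.sub_re, Complex.sub_im, hpdef] at h3
        linarith
      have h1 := hN z hzE (hsub' hzz) p hpb (Or.inr (by simp [hpdef]))
      have h2 := hN w hwE (hsub' hw) p hpb (Or.inl (by simp [hpdef]))
      have h3 : ‖p - z‖ ≤ ‖w - z‖ := by
        have : p - z = (((w - z).re : ℝ) : ℂ) := by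
          apply Complex.ext <;> simp [hpdef]
        rw [this, Complex.norm_real]
        exact Complex.abs_re_le_norm _
      have h4 : ‖p - w‖ ≤ ‖w - z‖ := by
        have : p - w = ((-(w - z).im : ℝ) : ℂ) * Complex.I := by
          apply Complex.ext <;> simp [hpdef]
        rw [this, norm_mul, Complex.norm_real, Complex.norm_I, mul_one, norm_neg]
        exact Complex.abs_im_le_norm _
      have h5 : ‖F w - F z‖ ≤ ‖F p - F z‖ + ‖F p - F w‖ := by
        rw [show F w - F z = (F p - F z) - (F p - F w) by ring]
        exact norm_sub_le _ _
      have h6 := mul_le_mul_of_nonneg_left h3 hN0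
      have h7 := mul_le_mul_of_nonneg_left h4 hN0
      have h8 := mul_le_mul_of_nonneg_right hCN (norm_nonneg (w - z))
      linarith
    · intro t ht0 ht
      have h1 : z - t ∈ closedBall z (ρ / 4) := by
        simpa [abs_of_nonneg ht0] using ht
      have h2 := hN z hzE (hsub' hzz) _ (hsub' h1) (Or.inr (by simp))
      have h3 : ‖z - t - z‖ = t := by
        simp [abs_of_nonneg ht0]
      rw [h3] at h2
      exact h2.trans (mul_le_mul_of_nonneg_right (by linarith) ht0)
    · intro w hw
      have h1 := hM w (ball_subset_closedBall (hsub' (sphere_subset_closedBall hw)))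
      have h2 := hM z (ball_subset_closedBall (hsub' hzz))
      have := norm_sub_le (F w) (F z)
      linarith
  refine ⟨ρ / 32, by positivity, ⟨5 * C, by positivity⟩, ?_⟩
  refine LipschitzOnWith.of_dist_le_mul fun w hw w' hw' => ?_
  change _ ≤ 5 * C * _
  rw [mem_ball] at hw hw'
  have hww : dist w' w < ρ / 16 := by
    have := dist_triangle_right w' w a
    linarith
  rw [dist_comm (F w), dist_comm w]
  by_cases hwE : w ∈ E
  · have := key w hwE (by rw [mem_ball]; linarith) w' (by rw [mem_closedBall]; linarith)
    nlinarith [dist_nonneg (x := w') (y := w)]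
  have hEne : E.Nonempty := ⟨a, ha⟩
  set δ := infDist w E with hδ
  have hδ0 : 0 < δ := (hE.notMem_iff_infDist_pos hEne).1 hwE
  have hδs : δ < ρ / 32 := (infDist_le_dist_of_mem ha).trans_lt hw
  obtain ⟨z, hzE, hz⟩ := (infDist_lt_iff (x := w) (r := 2 * δ) hEne).1 (by linarith)
  have hza : z ∈ ball a (ρ / 4) := by
    rw [mem_ball]
    have := dist_triangle_left z a w
    linarith
  have hwz : dist (F w) (F z) ≤ C * (2 * δ) :=
    (key z hzE hza w (by rw [mem_closedBall]; linarith)).trans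
      (mul_le_mul_of_nonneg_left hz.le hC0)
  -- If `w'` is closer to `w` than `E` is, the Schwarz lemma applies on the disc of radius δ, whose
  -- image has radius at most (3 + 2)Cδ. Otherwise the detour through `z` costs at most (3 + 2)C
  -- times the distance.
  by_cases hlt : dist w' w < δ
  · have hball : ∀ x ∈ ball w δ, x ∉ E := fun x hx hxE => by
      have := infDist_le_dist_of_mem (x := w) hxE
      rw [mem_ball, dist_comm] at hx
      linarith
    have := Complex.dist_le_div_mul_dist_of_mapsTo_ball (f := F) (c := w) (R₁ := δ)
      (R₂ := 5 * C * δ) (z := w') (fun x hx => ?_) (fun x hx => ?_) hlt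
    · rwa [mul_div_assoc, div_self hδ0.ne', mul_one] at this
    · refine (hd x ?_ (hball x hx)).differentiableWithinAt
      rw [mem_ball] at hx ⊢
      have := dist_triangle x w a
      linarith
    · rw [mem_ball] at hx
      have h1 := dist_triangle x w z
      have h2 := key z hzE hza x (by rw [mem_closedBall]; linarith)
      have h3 : C * dist x z ≤ C * (3 * δ) := mul_le_mul_of_nonneg_left (by linarith) hC0
      have h4 := dist_triangle_right (F x) (F w) (F z)
      rw [mem_closedBall]
      linarith
  · have h1 := dist_triangle w' w z
    have h2 := key z hzE hza w' (by rw [mem_closedBall]; linarith)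
    have h3 : C * dist w' z ≤ C * (3 * dist w' w) := mul_le_mul_of_nonneg_left (by linarith) hC0
    have h4 : C * (2 * δ) ≤ C * (2 * dist w' w) := mul_le_mul_of_nonneg_left (by linarith) hC0
    have h5 := dist_triangle_right (F w') (F w) (F z)
    linarith

/-! ### Holomorphy from one-sided Gateaux derivatives. -/

/-- A two-sided line derivative from one-sided derivatives along `w` and `-w`. -/
theorem hasLineDerivAt_of_tendsto_right {V : Type*} [AddCommGroup V] [Module ℝ V]
    {G : Type*} [NormedAddCommGroup G] [NormedSpace ℝ G] {f : V → G} {x w : V} {c : G}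
    (h₁ : Tendsto (fun ε : ℝ => ε⁻¹ • (f (x + ε • w) - f x)) (𝓝[>] 0) (𝓝 c))
    (h₂ : Tendsto (fun ε : ℝ => ε⁻¹ • (f (x + ε • -w) - f x)) (𝓝[>] 0) (𝓝 (-c))) :
    HasLineDerivAt ℝ f c x w := by
  rw [HasLineDerivAt, hasDerivAt_iff_tendsto_slope_zero]
  simp only [zero_add, zero_smul, add_zero]
  rw [← nhdsLT_sup_nhdsGT, tendsto_sup]
  refine ⟨?_, h₁⟩
  have h : Tendsto (fun t : ℝ => -t) (𝓝[<] 0) (𝓝[>] 0) := by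
    simpa using tendsto_neg_nhdsLT (a := (0 : ℝ))
  simpa [Function.comp_def, inv_neg] using (h₂.comp h).neg

open Set Metric in
/-- A function that is Lipschitz near `z` and whose one-sided Gateaux derivative at `z`
is complex linear is complex differentiable at `z`. -/
theorem LipschitzOnWith.differentiableAt_of_gateaux {F : ℂ → ℂ} {z d : ℂ} {s : Set ℂ} (hs : s ∈ 𝓝 z)
    {K : NNReal} (hF : LipschitzOnWith K F s)
    (hd : ∀ w : ℂ, Tendsto (fun ε : ℝ => ε⁻¹ • (F (z + ε • w) - F z)) (𝓝[>] 0) (𝓝 (w * d))) :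
    DifferentiableAt ℂ F z := by
  -- A globally Lipschitz extension, which agrees with `F` near `z` and therefore has the same line
  -- derivatives there.
  obtain ⟨g, hg, hFg⟩ := hF.extend_finite_dimension
  have hev : F =ᶠ[𝓝 z] g := by filter_upwards [hs] with x hx using hFg hx
  have h1 : HasFDerivAt g ((ContinuousLinearMap.toSpanSingleton ℂ d).restrictScalars ℝ) z := by
    refine hg.hasFDerivAt_of_hasLineDerivAt_of_closure (s := univ) (by simp) fun w _ => ?_
    refine (hasLineDerivAt_of_tendsto_right ?_ ?_).congr_of_eventuallyEq hev.symm
    · simpa using hd w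
    · simpa using hd (-w)
  have h2 : HasFDerivAt g (ContinuousLinearMap.toSpanSingleton ℂ d) z :=
    hasFDerivAt_of_restrictScalars ℝ h1 rfl
  exact (h2.congr_of_eventuallyEq hev).differentiableAt

open Set Metric in
/-- A continuous function on an open set all of whose one-sided Gateaux derivatives exist and are
complex linear in the direction is holomorphic. -/
theorem analyticOnNhd_of_gateaux {D : Set ℂ} (hD : IsOpen D) {F d : ℂ → ℂ} (hF : ContinuousOn F D)
    (hd : ∀ z ∈ D, ∀ w : ℂ,
      Tendsto (fun ε : ℝ => ε⁻¹ • (F (z + ε • w) - F z)) (𝓝[>] 0) (𝓝 (w * d z))) :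
    AnalyticOnNhd ℂ F D := by
  set E : Set ℂ := {z | AnalyticAt ℂ F z}ᶜ with hEdef
  have hE : IsClosed E := (isOpen_analyticAt ℂ F).isClosed_compl
  have hdE : ∀ w, w ∉ E → DifferentiableAt ℂ F w := fun w hw =>
    (not_not.1 hw : AnalyticAt ℂ F w).differentiableAt
  by_contra hcon
  obtain ⟨z₀, hz₀D, hz₀E⟩ : ∃ z ∈ D, z ∈ E := by
    simpa [AnalyticOnNhd, hEdef] using hcon
  set X : Set ℂ := D ∩ E with hX
  have hXl : IsLocallyClosed X := ⟨D, E, hD, hE, rfl⟩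
  -- This makes `X` a Baire space.
  have : LocallyCompactSpace X := hXl.locallyCompactSpace
  have : Nonempty X := ⟨⟨z₀, hz₀D, hz₀E⟩⟩
  set A : ℕ → Set X := fun n => {z | ∀ u ∈ ({1, -1, Complex.I, -Complex.I} : Set ℂ),
    ∀ t : ℝ, 0 ≤ t → t ≤ 1 / (n + 1) → (z : ℂ) + t • u ∈ D →
      ‖F (z + t • u) - F z‖ ≤ (n + 1) * t} with hA
  have hAc : ∀ n, IsClosed (A n) := by
    intro n
    rw [← isOpen_compl_iff, isOpen_iff_mem_nhds]
    intro z hz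
    simp only [hA, mem_compl_iff, mem_ofPred_eq, not_forall] at hz
    obtain ⟨u, hu, t, ht0, ht1, htD, hlt⟩ := hz
    have hc1 : ContinuousAt (fun x : X => F ((x : ℂ) + t • u)) z :=
      ContinuousAt.comp (f := fun x : X => (x : ℂ) + t • u) (hF.continuousAt (hD.mem_nhds htD))
        (by fun_prop)
    have hc2 : ContinuousAt (fun x : X => F (x : ℂ)) z :=
      ContinuousAt.comp (f := fun x : X => (x : ℂ)) (hF.continuousAt (hD.mem_nhds z.2.1))
        (by fun_prop)
    have h1 : ∀ᶠ x : X in 𝓝 z, (n + 1) * t < ‖F ((x : ℂ) + t • u) - F x‖ :=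
      (hc1.sub hc2).norm.eventually (lt_mem_nhds (not_le.1 hlt))
    have h2 : ∀ᶠ x : X in 𝓝 z, (x : ℂ) + t • u ∈ D :=
      (by fun_prop : ContinuousAt (fun x : X => (x : ℂ) + t • u) z).eventually (hD.mem_nhds htD)
    filter_upwards [h1, h2] with x hx1 hx2 hxA
    exact absurd (hxA u hu t ht0 ht1 hx2) (not_le.2 hx1)
  have hAU : ⋃ n, A n = univ := by
    refine eq_univ_of_forall fun z => mem_iUnion.2 ?_
    -- The bound is asked for all larger `m` so that one index serves the four directions.
    have h1 : ∀ u : ℂ, ∃ n : ℕ, ∀ m : ℕ, n ≤ m → ∀ t : ℝ, 0 ≤ t → t ≤ 1 / (m + 1) →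
        ‖F (z + t • u) - F z‖ ≤ (m + 1) * t := by
      intro u
      have h2 := (hd z z.2.1 u).norm.eventually (gt_mem_nhds (lt_add_one ‖u * d z‖))
      rw [eventually_nhdsWithin_iff] at h2
      obtain ⟨η, hη, h3⟩ := Metric.eventually_nhds_iff.1 h2
      obtain ⟨n₁, hn₁⟩ := exists_nat_gt (‖u * d z‖ + 1)
      obtain ⟨n₂, hn₂⟩ := exists_nat_one_div_lt hη
      refine ⟨max n₁ n₂, fun m hm t ht0 ht1 => ?_⟩
      rcases ht0.eq_or_lt with rfl | ht0'
      · simp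
      have hm1 : (n₁ : ℝ) ≤ m := by exact_mod_cast (le_max_left _ _).trans hm
      have hm2 : (n₂ : ℝ) ≤ m := by exact_mod_cast (le_max_right _ _).trans hm
      have hm3 : (1 : ℝ) / (m + 1) ≤ 1 / (n₂ + 1) :=
        one_div_le_one_div_of_le (by positivity) (by linarith)
      have h4 := h3 (y := t) (by rw [Real.dist_eq, sub_zero, abs_of_pos ht0']; linarith) ht0'
      rw [norm_smul, norm_inv, Real.norm_of_nonneg ht0, inv_mul_lt_iff₀ ht0'] at h4
      rw [mul_comm _ t]
      refine h4.le.trans (mul_le_mul_of_nonneg_left ?_ ht0)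
      linarith
    obtain ⟨n1, h1'⟩ := h1 1
    obtain ⟨n2, h2'⟩ := h1 (-1)
    obtain ⟨n3, h3'⟩ := h1 Complex.I
    obtain ⟨n4, h4'⟩ := h1 (-Complex.I)
    refine ⟨max (max n1 n2) (max n3 n4), ?_⟩
    rintro u (rfl | rfl | rfl | rfl) t ht0 ht1 -
    · exact h1' _ (by simp) t ht0 ht1
    · exact h2' _ (by simp) t ht0 ht1
    · exact h3' _ (by simp) t ht0 ht1
    · exact h4' _ (by simp) t ht0 ht1
  obtain ⟨n, ⟨⟨a, haX⟩, haA⟩⟩ := nonempty_interior_of_iUnion_of_closed hAc hAU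
  rw [mem_interior_iff_mem_nhds, Metric.mem_nhds_iff] at haA
  obtain ⟨ρ₁, hρ₁, hA₁⟩ := haA
  obtain ⟨ρ₂, hρ₂, hD₂⟩ := Metric.nhds_basis_closedBall.mem_iff.1 (hD.mem_nhds haX.1)
  -- The last term keeps any two points of the ball within the range `1 / (n + 1)` of the estimate
  -- defining `A n`.
  set ρ : ℝ := min (min ρ₁ ρ₂) (1 / (2 * (n + 1))) with hρ
  have hρ0 : 0 < ρ := by positivity
  have hρ1 : ρ ≤ ρ₁ := (min_le_left _ _).trans (min_le_left _ _)
  have hρ2 : ρ ≤ ρ₂ := (min_le_left _ _).trans (min_le_right _ _)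
  have hρ3 : 2 * ρ ≤ 1 / (n + 1) := by
    have : ρ ≤ 1 / (2 * (n + 1)) := min_le_right _ _
    calc 2 * ρ ≤ 2 * (1 / (2 * (n + 1))) := by linarith
      _ = 1 / (n + 1) := by field_simp
  have hρD : closedBall a ρ ⊆ D := (closedBall_subset_closedBall hρ2).trans hD₂
  obtain ⟨s, hs, K, hK⟩ := exists_lipschitzOnWith_ball_of_le_on_axes (N := n + 1) hE haX.2 hρ0
    (hF.mono hρD) (fun w _ hw => hdE w hw) (by
      intro z hzE hz w hw hwz
      have hzD : z ∈ D := hρD (ball_subset_closedBall hz)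
      have hzA : (⟨z, hzD, hzE⟩ : X) ∈ A n := hA₁ (ball_subset_ball hρ1 hz)
      have hwD : w ∈ D := hρD (ball_subset_closedBall hw)
      have hlt : ‖w - z‖ ≤ 1 / (n + 1) := by
        rw [mem_ball] at hw hz
        have := dist_triangle_right w z a
        rw [dist_eq_norm w z] at this
        linarith
      obtain ⟨u, hu, hwu⟩ : ∃ u ∈ ({1, -1, Complex.I, -Complex.I} : Set ℂ),
          w - z = ‖w - z‖ • u := by
        generalize w - z = v at hwz
        have hv : (‖v‖ : ℝ) = |v.re| + |v.im| := by
          rcases hwz with h | h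
          · have : v = (v.im : ℂ) * Complex.I := by apply Complex.ext <;> simp [h]
            rw [h, abs_zero, zero_add]
            conv_lhs => rw [this]
            simp
          · have : v = (v.re : ℂ) := by apply Complex.ext <;> simp [h]
            rw [h, abs_zero, add_zero]
            conv_lhs => rw [this]
            simp
        rw [hv]
        rcases hwz with h | h
        · rcases abs_cases v.im with ⟨h1, _⟩ | ⟨h1, _⟩
          · exact ⟨Complex.I, by simp, by apply Complex.ext <;> simp [h, h1]⟩
          · exact ⟨-Complex.I, by simp, by apply Complex.ext <;> simp [h, h1]⟩
        · rcases abs_cases v.re with ⟨h1, _⟩ | ⟨h1, _⟩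
          · exact ⟨1, by simp, by apply Complex.ext <;> simp [h, h1]⟩
          · exact ⟨-1, by simp, by apply Complex.ext <;> simp [h, h1]⟩
      have hw' : z + ‖w - z‖ • u = w := by rw [← hwu]; ring
      have := hzA u hu ‖w - z‖ (norm_nonneg _) hlt (by simpa only [hw'] using hwD)
      simpa only [hw'] using this)
  refine haX.2 ?_
  have hball : ball a (min s ρ) ∈ 𝓝 a := ball_mem_nhds _ (lt_min hs hρ0)
  refine DifferentiableOn.analyticAt (s := ball a (min s ρ)) (fun w hw => ?_) hball
  have hws : w ∈ ball a s := ball_subset_ball (min_le_left _ _) hw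
  have hwD : w ∈ D := hρD (ball_subset_closedBall (ball_subset_ball (min_le_right _ _) hw))
  exact (hK.differentiableAt_of_gateaux (isOpen_ball.mem_nhds hws)
    (hd w hwD)).differentiableWithinAt

/-! ### Descent along the fibres of a linear map. -/

/-- A continuous function with vanishing right derivative along a segment takes the same value at
both ends. -/
theorem eq_of_segment_of_tendsto_zero {V : Type*} [NormedAddCommGroup V] [NormedSpace ℝ V]
    {Ω : Set V} {u : V → ℂ} (hu : ContinuousOn u Ω) {p q : V} (hpq : segment ℝ p q ⊆ Ω)
    (hd : ∀ x ∈ Ω, Tendsto (fun ε : ℝ => ε⁻¹ • (u (x + ε • (q - p)) - u x)) (𝓝[>] 0) (𝓝 0)) :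
    u q = u p := by
  have hmem : ∀ t ∈ Set.Icc (0 : ℝ) 1, p + t • (q - p) ∈ Ω := fun t ht =>
    hpq (by rw [segment_eq_image']; exact ⟨t, ht, rfl⟩)
  have h := constant_of_has_deriv_right_zero (f := fun t : ℝ => u (p + t • (q - p)))
    (a := 0) (b := 1) (hu.comp (by fun_prop) hmem) (fun t ht => ?_) 1 (by simp)
  · simpa using h
  · rw [← hasDerivWithinAt_Ioi_iff_Ici, hasDerivWithinAt_iff_tendsto_slope' (by simp)]
    have h1 : Tendsto (fun y : ℝ => y - t) (𝓝[>] t) (𝓝[>] 0) := by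
      refine tendsto_nhdsWithin_of_tendsto_nhds_of_eventually_within _ ?_ ?_
      · have : Continuous fun y : ℝ => y - t := by fun_prop
        simpa using (this.tendsto t).mono_left nhdsWithin_le_nhds
      · filter_upwards [self_mem_nhdsWithin] with y hy using sub_pos.2 (Set.mem_Ioi.1 hy)
    refine ((hd _ (hmem t ⟨ht.1, ht.2.le⟩)).comp h1).congr fun y => ?_
    simp only [Function.comp, slope, vsub_eq_sub]
    rw [show p + t • (q - p) + (y - t) • (q - p) = p + y • (q - p) by module]

theorem HasDerivAt.tendsto_gateaux {F : ℂ → ℂ} {ξ F' : ℂ} (h : HasDerivAt F F' ξ) (w : ℂ) :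
    Tendsto (fun ε : ℝ => ε⁻¹ • (F (ξ + ε • w) - F ξ)) (𝓝[>] 0) (𝓝 (w * F')) := by
  have h1 : HasLineDerivAt ℝ F (w * F') ξ w := by
    simpa using (h.hasFDerivAt.restrictScalars ℝ).hasLineDerivAt w
  simpa using h1.tendsto_slope_zero_right

/-- A function on an open set `Ω`, convex along the fibres of `l`, whose one-sided Gateaux
derivative in the direction `h` is `l h * d` is the pull-back by `l` of a holomorphic function with
derivative `d`. -/
theorem exists_analyticOnNhd_comp_of_gateaux {V : Type*} [NormedAddCommGroup V] [NormedSpace ℝ V]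
    [FiniteDimensional ℝ V] {l : V →ₗ[ℝ] ℂ} (hl : Function.Surjective l) {Ω : Set V}
    (hΩ : IsOpen Ω) (hconv : ∀ p ∈ Ω, ∀ q ∈ Ω, l p = l q → segment ℝ p q ⊆ Ω) {u d : V → ℂ}
    (hu : ContinuousOn u Ω)
    (hd : ∀ p ∈ Ω, ∀ h : V,
      Tendsto (fun ε : ℝ => ε⁻¹ • (u (p + ε • h) - u p)) (𝓝[>] 0) (𝓝 (l h * d p))) :
    ∃ F : ℂ → ℂ, AnalyticOnNhd ℂ F (l '' Ω) ∧
      ∀ p ∈ Ω, u p = F (l p) ∧ d p = deriv F (l p) := by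
  have hconst : ∀ p ∈ Ω, ∀ q ∈ Ω, l p = l q → u q = u p := by
    intro p hp q hq hpq
    refine eq_of_segment_of_tendsto_zero hu (hconv p hp q hq hpq) fun x hx => ?_
    simpa [hpq] using hd x hx (q - p)
  obtain ⟨s, hs⟩ := l.exists_rightInverse_of_surjective (LinearMap.range_eq_top.2 hl)
  have hs' : ∀ w, l (s w) = w := fun w => LinearMap.congr_fun hs w
  have hsc : Continuous s := s.continuous_of_finiteDimensional
  have hopen : IsOpen (l '' Ω) := LinearMap.isOpenMap_of_finiteDimensional l hl Ω hΩ
  -- `σ` may be discontinuous. Constancy on fibres lets it be replaced near `l p` by the affine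
  -- section η ↦ p + s(η - l p), which transfers continuity and derivatives from `u` to `F`.
  choose! σ hσΩ hσ using fun ξ (hξ : ξ ∈ l '' Ω) => hξ
  have hF : ∀ p ∈ Ω, u (σ (l p)) = u p := fun p hp =>
    hconst p hp _ (hσΩ _ ⟨p, hp, rfl⟩) (hσ _ ⟨p, hp, rfl⟩).symm
  set F : ℂ → ℂ := fun ξ => u (σ ξ) with hFdef
  have hloc : ∀ p ∈ Ω, ∀ᶠ η in 𝓝 (l p), p + s (η - l p) ∈ Ω ∧ F η = u (p + s (η - l p)) := by
    intro p hp
    have hc : Continuous fun η => p + s (η - l p) := by fun_prop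
    have : ∀ᶠ η in 𝓝 (l p), p + s (η - l p) ∈ Ω :=
      (hc.tendsto (l p)).eventually (hΩ.mem_nhds (by simpa using hp))
    filter_upwards [this] with η hη
    refine ⟨hη, ?_⟩
    rw [← hF _ hη]
    simp [hFdef, hs']
  have hFc : ContinuousOn F (l '' Ω) := by
    rintro _ ⟨p, hp, rfl⟩
    refine ContinuousAt.continuousWithinAt ?_
    refine ContinuousAt.congr ?_ ((hloc p hp).mono fun η h => h.2.symm)
    have hc : Continuous fun η => p + s (η - l p) := by fun_prop
    refine ContinuousAt.comp (f := fun η => p + s (η - l p)) ?_ hc.continuousAt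
    exact hu.continuousAt (hΩ.mem_nhds (by simpa using hp))
  have hFd : ∀ p ∈ Ω, ∀ w : ℂ, Tendsto (fun ε : ℝ => ε⁻¹ • (F (l p + ε • w) - F (l p)))
      (𝓝[>] 0) (𝓝 (w * d p)) := by
    intro p hp w
    have h1 := hd p hp (s w)
    rw [hs'] at h1
    refine h1.congr' ?_
    have hc : Continuous fun ε : ℝ => l p + ε • w := by fun_prop
    have h2 : Tendsto (fun ε : ℝ => l p + ε • w) (𝓝[>] 0) (𝓝 (l p)) := by
      simpa using (hc.tendsto 0).mono_left (nhdsWithin_le_nhds (s := Set.Ioi 0))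
    filter_upwards [h2.eventually (hloc p hp)] with ε hε
    rw [hε.2, add_sub_cancel_left, map_smul]
    simp only [hFdef, hF p hp]
  have hFa : AnalyticOnNhd ℂ F (l '' Ω) :=
    analyticOnNhd_of_gateaux (d := fun ξ => d (σ ξ)) hopen hFc fun ξ hξ w => by
      simpa [hσ ξ hξ] using hFd (σ ξ) (hσΩ ξ hξ) w
  refine ⟨F, hFa, fun p hp => ⟨(hF p hp).symm, ?_⟩⟩
  have h1 := (hFa (l p) ⟨p, hp, rfl⟩).differentiableAt.hasDerivAt
  simpa using tendsto_nhds_unique (hFd p hp 1) (h1.tendsto_gateaux 1)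

/-! ### Gateaux derivatives in matrix coordinates. -/

namespace HC

theorem isInducing_coords : IsInducing coords :=
  (EuclideanSpace.equiv (Fin 4) ℂ).toHomeomorph.isInducing.comp (⟨rfl⟩ : IsInducing coordsL2)

theorem tendsto_nhds_iff_coords {α : Type*} {l : Filter α} {f : α → Biquat} {a : Biquat} :
    Tendsto f l (𝓝 a) ↔ ∀ k, Tendsto (fun x => coords (f x) k) l (𝓝 (coords a k)) := by
  rw [isInducing_coords.tendsto_nhds_iff, tendsto_pi_nhds]
  rfl

theorem continuousOn_iff_coords {α : Type*} [TopologicalSpace α] {f : α → Biquat} {s : Set α} :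
    ContinuousOn f s ↔ ∀ k, ContinuousOn (fun x => coords (f x) k) s := by
  rw [isInducing_coords.continuousOn_iff, continuousOn_pi]
  rfl

theorem continuous_coords_apply (k : Fin 4) : Continuous fun a : Biquat => coords a k :=
  (continuous_apply k).comp isInducing_coords.continuous

theorem continuous_f₁ : Continuous f₁ := (continuous_coords_apply 0).add (continuous_coords_apply 2)

theorem continuous_f₂ : Continuous f₂ := (continuous_coords_apply 1).add (continuous_coords_apply 3)

theorem coords_real_smul (c : ℝ) (a : Biquat) (k : Fin 4) : coords (c • a) k = c • coords a k := by
  rw [LinearMap.map_smul_of_tower, Pi.smul_apply]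

/-- The coordinate map `ℝ³ → E₃`, `(x, y, z) ↦ x i₁ + y i₂ + z i₃`. -/
noncomputable def frameMap (a₁ a₂ b₁ b₂ : ℂ) : (Fin 3 → ℝ) →ₗ[ℝ] Biquat :=
  Fintype.linearCombination ℝ (frame a₁ a₂ b₁ b₂)

theorem E₃_eq_range (a₁ a₂ b₁ b₂ : ℂ) : E₃ a₁ a₂ b₁ b₂ = (frameMap a₁ a₂ b₁ b₂).range :=
  (Fintype.range_linearCombination _ _).symm

theorem coords_frameMap (a₁ a₂ b₁ b₂ : ℂ) (p : Fin 3 → ℝ) :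
    coords (frameMap a₁ a₂ b₁ b₂ p) =
      ![p 0 + p 1 * a₁ + p 2 * b₁, p 0 + p 1 * a₂ + p 2 * b₂, 0, 0] := by
  have hI := Complex.I_mul_I
  ext k
  fin_cases k <;> simp [coords, frameMap, Fintype.linearCombination_apply, Fin.sum_univ_three, frame]
    <;> grind

/-- In the basis `e₁, e₂, e₃, e₄`, multiplication is the multiplication of `2 × 2` matrices. -/
theorem coords_mul (a b : Biquat) :
    coords (a * b) = ![coords a 0 * coords b 0 + coords a 2 * coords b 3,
      coords a 1 * coords b 1 + coords a 3 * coords b 2,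
      coords a 0 * coords b 2 + coords a 2 * coords b 1,
      coords a 1 * coords b 3 + coords a 3 * coords b 0] := by
  have hI := Complex.I_mul_I
  ext k
  fin_cases k <;> simp [coords] <;> grind

/-- The coordinatewise description of Gateaux derivatives and their iterates. Here `H Φ d ζ` says
that `d` is the derivative of `Φ` at `ζ`, where the `k`-th coordinate of the product of `P h` and
`d` is `φ k (P h)` times that of `d`. -/
theorem exists_analytic_coords {V : Type*} [NormedAddCommGroup V] [NormedSpace ℝ V]
    [FiniteDimensional ℝ V] (P : V →ₗ[ℝ] Biquat) {φ : Fin 4 → Biquat →ₗ[ℂ] ℂ}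
    (hφ : ∀ k, Continuous (φ k)) (hsurj : ∀ k, Function.Surjective fun p => φ k (P p))
    {Ω : Set V} (hΩ : IsOpen Ω)
    (hconv : ∀ k, ∀ p ∈ Ω, ∀ q ∈ Ω, φ k (P p) = φ k (P q) → segment ℝ p q ⊆ Ω)
    {H : (Biquat → Biquat) → Biquat → Biquat → Prop} {D : (Biquat → Biquat) → Biquat → Biquat}
    (hH : ∀ Φ d p, p ∈ Ω → (H Φ d (P p) ↔ ∀ h k, Tendsto (fun ε : ℝ =>
      ε⁻¹ • (coords (Φ (P (p + ε • h))) k - coords (Φ (P p)) k)) (𝓝[>] 0)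
        (𝓝 (φ k (P h) * coords d k))))
    (hD : ∀ Φ d p, p ∈ Ω → H Φ d (P p) → D Φ (P p) = d)
    {Φ : Biquat → Biquat} (hc : ContinuousOn Φ (P '' Ω)) (hd : ∀ ζ ∈ P '' Ω, ∃ d, H Φ d ζ) :
    (∀ n, ContinuousOn (D^[n] Φ) (P '' Ω) ∧ ∀ ζ ∈ P '' Ω, ∃ d, H (D^[n] Φ) d ζ) ∧
      ∃ F : Fin 4 → ℂ → ℂ, (∀ k, AnalyticOnNhd ℂ (F k) (φ k '' (P '' Ω))) ∧
        ∀ ζ ∈ P '' Ω, ∀ k, coords (Φ ζ) k = F k (φ k ζ) ∧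
          coords (D Φ ζ) k = deriv (F k) (φ k ζ) := by
  have hreal : ∀ (φ : Biquat →ₗ[ℂ] ℂ) (c : ℝ) (a : Biquat), φ (c • a) = c • φ a :=
    fun φ c a => φ.map_smul_of_tower c a
  have hPc : ContinuousOn P Ω := by
    refine continuousOn_iff_coords.2 fun k => Continuous.continuousOn ?_
    let m : V →ₗ[ℝ] ℂ :=
      { toFun := fun p => coords (P p) k
        map_add' := by simp
        map_smul' := fun c p => by simp [coords_real_smul] }
    exact m.continuous_of_finiteDimensional
  let l : Fin 4 → V →ₗ[ℝ] ℂ := fun k =>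
    { toFun := fun p => φ k (P p)
      map_add' := by simp
      map_smul' := fun c p => by simp [hreal] }
  -- analytic coordinates give a derivative, whose coordinates are again analytic
  have step : ∀ (Φ : Biquat → Biquat) (F : Fin 4 → ℂ → ℂ),
      (∀ k, AnalyticOnNhd ℂ (F k) (φ k '' (P '' Ω))) →
      (∀ ζ ∈ P '' Ω, ∀ k, coords (Φ ζ) k = F k (φ k ζ)) →
      ContinuousOn Φ (P '' Ω) ∧ ∀ ζ ∈ P '' Ω, (∃ d, H Φ d ζ) ∧
        ∀ k, coords (D Φ ζ) k = deriv (F k) (φ k ζ) := by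
    intro Φ F hF hΦ
    refine ⟨continuousOn_iff_coords.2 fun k => ?_, ?_⟩
    · exact ((hF k).continuousOn.comp (hφ k).continuousOn (Set.mapsTo_image _ _)).congr
        fun ζ hζ => hΦ ζ hζ k
    · rintro _ ⟨p, hp, rfl⟩
      set c : Fin 4 → ℂ := fun k => deriv (F k) (φ k (P p)) with hcdef
      have hcd := coords_sum c
      set d := c 0 • e₁ + c 1 • e₂ + c 2 • e₃ + c 3 • e₄
      have hHd : H Φ d (P p) := by
        rw [hH Φ d p hp]
        intro h k
        have h1 := (hF k _ ⟨P p, ⟨p, hp, rfl⟩, rfl⟩).differentiableAt.hasDerivAt.tendsto_gateaux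
          (φ k (P h))
        rw [hcd]
        refine h1.congr' ?_
        have hcont : Continuous fun ε : ℝ => p + ε • h := by fun_prop
        have h2 : ∀ᶠ ε : ℝ in 𝓝[>] 0, p + ε • h ∈ Ω :=
          nhdsWithin_le_nhds ((hcont.tendsto 0).eventually (hΩ.mem_nhds (by simpa using hp)))
        filter_upwards [h2] with ε hε
        rw [hΦ _ ⟨_, hε, rfl⟩, hΦ _ ⟨p, hp, rfl⟩, map_add P, map_smul P, map_add, hreal]
      refine ⟨⟨d, hHd⟩, fun k => ?_⟩
      rw [hD Φ d p hp hHd, hcd]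
  -- Convexity and the differentiability of `Φ` enter only here; the higher derivatives use `step`
  -- alone.
  have hrep : ∃ F : Fin 4 → ℂ → ℂ, (∀ k, AnalyticOnNhd ℂ (F k) (φ k '' (P '' Ω))) ∧
      ∀ ζ ∈ P '' Ω, ∀ k, coords (Φ ζ) k = F k (φ k ζ) := by
    choose! δ hδ using hd
    have : ∀ k, ∃ F : ℂ → ℂ, AnalyticOnNhd ℂ F (l k '' Ω) ∧ ∀ p ∈ Ω,
        coords (Φ (P p)) k = F (l k p) ∧ coords (δ (P p)) k = deriv F (l k p) := fun k =>
      exists_analyticOnNhd_comp_of_gateaux (hsurj k) hΩ (hconv k)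
        (continuousOn_iff_coords.1 (hc.comp hPc (Set.mapsTo_image _ _)) k)
        fun p hp h => (hH Φ _ p hp).1 (hδ _ ⟨p, hp, rfl⟩) h k
    choose F hFa hF using this
    refine ⟨F, fun k => ?_, ?_⟩
    · rw [Set.image_image]
      exact hFa k
    · rintro _ ⟨p, hp, rfl⟩ k
      exact (hF k p hp).1
  have hiter : ∀ n, ∃ F : Fin 4 → ℂ → ℂ, (∀ k, AnalyticOnNhd ℂ (F k) (φ k '' (P '' Ω))) ∧
      ∀ ζ ∈ P '' Ω, ∀ k, coords ((D^[n] Φ) ζ) k = F k (φ k ζ) := by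
    intro n
    induction n with
    | zero => exact hrep
    | succ n ih =>
      obtain ⟨F, hF, hΦF⟩ := ih
      refine ⟨fun k => deriv (F k), fun k => (hF k).deriv, fun ζ hζ k => ?_⟩
      rw [Function.iterate_succ_apply']
      exact ((step _ F hF hΦF).2 ζ hζ).2 k
  refine ⟨fun n => ?_, ?_⟩
  · obtain ⟨F, hF, hΦF⟩ := hiter n
    have := step _ F hF hΦF
    exact ⟨this.1, fun ζ hζ => (this.2 ζ hζ).1⟩
  · obtain ⟨F, hF, hΦF⟩ := hrep
    exact ⟨F, hF, fun ζ hζ k => ⟨hΦF ζ hζ k, ((step _ F hF hΦF).2 ζ hζ).2 k⟩⟩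

theorem rightGDeriv_eq {E : Submodule ℝ Biquat} (hE : (1 : Biquat) ∈ E) {Φ : Biquat → Biquat}
    {d ζ : Biquat} (h : HasRightGDerivAt E Φ d ζ) : rightGDeriv E Φ ζ = d := by
  have h' : ∃ d, HasRightGDerivAt E Φ d ζ := ⟨d, h⟩
  rw [rightGDeriv, dif_pos h']
  exact h'.choose_spec.unique hE h

theorem leftGDeriv_eq {E : Submodule ℝ Biquat} (hE : (1 : Biquat) ∈ E) {Φ : Biquat → Biquat}
    {d ζ : Biquat} (h : HasLeftGDerivAt E Φ d ζ) : leftGDeriv E Φ ζ = d := by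
  have h' : ∃ d, HasLeftGDerivAt E Φ d ζ := ⟨d, h⟩
  rw [leftGDeriv, dif_pos h']
  exact h'.choose_spec.unique hE h

theorem f₁_frameMap (a₁ a₂ b₁ b₂ : ℂ) (p : Fin 3 → ℝ) :
    f₁ (frameMap a₁ a₂ b₁ b₂ p) = p 0 + p 1 * a₁ + p 2 * b₁ := by
  simp [f₁_apply, coords_frameMap]

theorem f₂_frameMap (a₁ a₂ b₁ b₂ : ℂ) (p : Fin 3 → ℝ) :
    f₂ (frameMap a₁ a₂ b₁ b₂ p) = p 0 + p 1 * a₂ + p 2 * b₂ := by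
  simp [f₂_apply, coords_frameMap]

/-- The fibres of f₁ and f₂ in the coordinates of `E₃` are parallel to L₁ and L₂, so directional
convexity is convexity along fibres. -/
theorem sub_mem_line {a b : ℂ} {p q : Fin 3 → ℝ}
    (h : (p 0 + p 1 * a + p 2 * b : ℂ) = q 0 + q 1 * a + q 2 * b) : q - p ∈ line a b := by
  have h1 := congrArg Complex.re h
  have h2 := congrArg Complex.im h
  simp at h1 h2
  refine ⟨?_, ?_⟩ <;> simp <;> linarith

/-- Left multiplication by a diagonal matrix scales the rows, `e₁, e₃` and `e₄, e₂`. -/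
theorem hasRightGDerivAt_frameMap_iff {a₁ a₂ b₁ b₂ : ℂ} {Φ : Biquat → Biquat} {d : Biquat}
    {p : Fin 3 → ℝ} :
    HasRightGDerivAt (E₃ a₁ a₂ b₁ b₂) Φ d (frameMap a₁ a₂ b₁ b₂ p) ↔
      ∀ (h : Fin 3 → ℝ) (k : Fin 4), Tendsto (fun ε : ℝ =>
        ε⁻¹ • (coords (Φ (frameMap a₁ a₂ b₁ b₂ (p + ε • h))) k -
          coords (Φ (frameMap a₁ a₂ b₁ b₂ p)) k)) (𝓝[>] 0)
        (𝓝 ((![f₁, f₂, f₁, f₂] : Fin 4 → Biquat →ₗ[ℂ] ℂ) k (frameMap a₁ a₂ b₁ b₂ h) *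
          coords d k)) := by
  simp only [HasRightGDerivAt, E₃_eq_range, LinearMap.mem_range, forall_exists_index,
    forall_apply_eq_imp_iff, tendsto_nhds_iff_coords, coords_real_smul, map_sub, Pi.sub_apply,
    map_add, map_smul (frameMap a₁ a₂ b₁ b₂)]
  refine forall_congr' fun h => forall_congr' fun k => ?_
  suffices coords (frameMap a₁ a₂ b₁ b₂ h * d) k =
      (![f₁, f₂, f₁, f₂] : Fin 4 → Biquat →ₗ[ℂ] ℂ) k (frameMap a₁ a₂ b₁ b₂ h) * coords d k by
    rw [this]
  fin_cases k <;> simp [coords_mul, coords_frameMap, f₁_frameMap, f₂_frameMap]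

/-- Right multiplication by a diagonal matrix scales the columns, `e₁, e₄` and `e₃, e₂`; hence the
third and fourth functionals trade places. -/
theorem hasLeftGDerivAt_frameMap_iff {a₁ a₂ b₁ b₂ : ℂ} {Φ : Biquat → Biquat} {d : Biquat}
    {p : Fin 3 → ℝ} :
    HasLeftGDerivAt (E₃ a₁ a₂ b₁ b₂) Φ d (frameMap a₁ a₂ b₁ b₂ p) ↔
      ∀ (h : Fin 3 → ℝ) (k : Fin 4), Tendsto (fun ε : ℝ =>
        ε⁻¹ • (coords (Φ (frameMap a₁ a₂ b₁ b₂ (p + ε • h))) k -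
          coords (Φ (frameMap a₁ a₂ b₁ b₂ p)) k)) (𝓝[>] 0)
        (𝓝 ((![f₁, f₂, f₂, f₁] : Fin 4 → Biquat →ₗ[ℂ] ℂ) k (frameMap a₁ a₂ b₁ b₂ h) *
          coords d k)) := by
  simp only [HasLeftGDerivAt, E₃_eq_range, LinearMap.mem_range, forall_exists_index,
    forall_apply_eq_imp_iff, tendsto_nhds_iff_coords, coords_real_smul, map_sub, Pi.sub_apply,
    map_add, map_smul (frameMap a₁ a₂ b₁ b₂)]
  refine forall_congr' fun h => forall_congr' fun k => ?_
  suffices coords (d * frameMap a₁ a₂ b₁ b₂ h) k =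
      (![f₁, f₂, f₂, f₁] : Fin 4 → Biquat →ₗ[ℂ] ℂ) k (frameMap a₁ a₂ b₁ b₂ h) * coords d k by
    rw [this]
  fin_cases k <;> simp [coords_mul, coords_frameMap, f₁_frameMap, f₂_frameMap, mul_comm]

end HC

/-! ### The representation theorem, right and left. -/

theorem mainTheorem4 (a₁ a₂ b₁ b₂ : ℂ)
    (hind : LinearIndependent ℝ (HC.frame a₁ a₂ b₁ b₂))
    (hf₁ : HC.f₁ '' (HC.E₃ a₁ a₂ b₁ b₂ : Set HC.Biquat) = Set.univ)
    (hf₂ : HC.f₂ '' (HC.E₃ a₁ a₂ b₁ b₂ : Set HC.Biquat) = Set.univ)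
    (Ω : Set (Fin 3 → ℝ)) (hΩ_open : IsOpen Ω) (hΩ_conn : IsConnected Ω)
    (hL₁ : HC.ConvexInDirection (HC.line a₁ b₁) Ω)
    (hL₂ : HC.ConvexInDirection (HC.line a₂ b₂) Ω)
    (Φ Ψ : HC.Biquat → HC.Biquat)
    (hΦ : HC.RightGMonogenicOn (HC.E₃ a₁ a₂ b₁ b₂) Φ (HC.domainζ a₁ a₂ b₁ b₂ Ω))
    (hΨ : HC.LeftGMonogenicOn (HC.E₃ a₁ a₂ b₁ b₂) Ψ (HC.domainζ a₁ a₂ b₁ b₂ Ω)) :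
    ((∀ n : ℕ, HC.RightGMonogenicOn (HC.E₃ a₁ a₂ b₁ b₂)
        ((HC.rightGDeriv (HC.E₃ a₁ a₂ b₁ b₂))^[n] Φ) (HC.domainζ a₁ a₂ b₁ b₂ Ω)) ∧
      ∃ F₁ F₂ F₃ F₄ : ℂ → ℂ,
        AnalyticOnNhd ℂ F₁ (HC.f₁ '' HC.domainζ a₁ a₂ b₁ b₂ Ω) ∧
        AnalyticOnNhd ℂ F₂ (HC.f₂ '' HC.domainζ a₁ a₂ b₁ b₂ Ω) ∧
        AnalyticOnNhd ℂ F₃ (HC.f₁ '' HC.domainζ a₁ a₂ b₁ b₂ Ω) ∧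
        AnalyticOnNhd ℂ F₄ (HC.f₂ '' HC.domainζ a₁ a₂ b₁ b₂ Ω) ∧
        ∀ ζ ∈ HC.domainζ a₁ a₂ b₁ b₂ Ω,
          Φ ζ = F₁ (HC.f₁ ζ) • HC.e₁ + F₂ (HC.f₂ ζ) • HC.e₂ +
            F₃ (HC.f₁ ζ) • HC.e₃ + F₄ (HC.f₂ ζ) • HC.e₄ ∧
          HC.rightGDeriv (HC.E₃ a₁ a₂ b₁ b₂) Φ ζ =
            deriv F₁ (HC.f₁ ζ) • HC.e₁ + deriv F₂ (HC.f₂ ζ) • HC.e₂ +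
            deriv F₃ (HC.f₁ ζ) • HC.e₃ + deriv F₄ (HC.f₂ ζ) • HC.e₄) ∧
    ((∀ n : ℕ, HC.LeftGMonogenicOn (HC.E₃ a₁ a₂ b₁ b₂)
        ((HC.leftGDeriv (HC.E₃ a₁ a₂ b₁ b₂))^[n] Ψ) (HC.domainζ a₁ a₂ b₁ b₂ Ω)) ∧
      ∃ F₁ F₂ F₃ F₄ : ℂ → ℂ,
        AnalyticOnNhd ℂ F₁ (HC.f₁ '' HC.domainζ a₁ a₂ b₁ b₂ Ω) ∧
        AnalyticOnNhd ℂ F₂ (HC.f₂ '' HC.domainζ a₁ a₂ b₁ b₂ Ω) ∧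
        AnalyticOnNhd ℂ F₃ (HC.f₂ '' HC.domainζ a₁ a₂ b₁ b₂ Ω) ∧
        AnalyticOnNhd ℂ F₄ (HC.f₁ '' HC.domainζ a₁ a₂ b₁ b₂ Ω) ∧
        ∀ ζ ∈ HC.domainζ a₁ a₂ b₁ b₂ Ω,
          Ψ ζ = F₁ (HC.f₁ ζ) • HC.e₁ + F₂ (HC.f₂ ζ) • HC.e₂ +
            F₃ (HC.f₂ ζ) • HC.e₃ + F₄ (HC.f₁ ζ) • HC.e₄ ∧
          HC.leftGDeriv (HC.E₃ a₁ a₂ b₁ b₂) Ψ ζ =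
            deriv F₁ (HC.f₁ ζ) • HC.e₁ + deriv F₂ (HC.f₂ ζ) • HC.e₂ +
            deriv F₃ (HC.f₂ ζ) • HC.e₃ + deriv F₄ (HC.f₁ ζ) • HC.e₄) := by
  set P := HC.frameMap a₁ a₂ b₁ b₂
  have hs₁ : Function.Surjective fun p => HC.f₁ (P p) := fun w => by
    obtain ⟨x, hx, rfl⟩ : w ∈ HC.f₁ '' (HC.E₃ a₁ a₂ b₁ b₂ : Set HC.Biquat) := by simp [hf₁]
    rw [HC.E₃_eq_range] at hx
    obtain ⟨p, rfl⟩ := hx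
    exact ⟨p, rfl⟩
  have hs₂ : Function.Surjective fun p => HC.f₂ (P p) := fun w => by
    obtain ⟨x, hx, rfl⟩ : w ∈ HC.f₂ '' (HC.E₃ a₁ a₂ b₁ b₂ : Set HC.Biquat) := by simp [hf₂]
    rw [HC.E₃_eq_range] at hx
    obtain ⟨p, rfl⟩ := hx
    exact ⟨p, rfl⟩
  have hc₁ : ∀ p ∈ Ω, ∀ q ∈ Ω, HC.f₁ (P p) = HC.f₁ (P q) → segment ℝ p q ⊆ Ω :=
    fun p hp q hq h => hL₁ p hp q hq (HC.sub_mem_line (by simpa only [P, HC.f₁_frameMap] using h))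
  have hc₂ : ∀ p ∈ Ω, ∀ q ∈ Ω, HC.f₂ (P p) = HC.f₂ (P q) → segment ℝ p q ⊆ Ω :=
    fun p hp q hq h => hL₂ p hp q hq (HC.sub_mem_line (by simpa only [P, HC.f₂_frameMap] using h))
  have h1 := HC.one_mem_E₃ a₁ a₂ b₁ b₂
  constructor
  · obtain ⟨hn, F, hFa, hF⟩ := HC.exists_analytic_coords P
      (φ := ![HC.f₁, HC.f₂, HC.f₁, HC.f₂])
      (by simp [Fin.forall_fin_succ, HC.continuous_f₁, HC.continuous_f₂])
      (by simp [Fin.forall_fin_succ, hs₁, hs₂]) hΩ_open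
      (by simp only [Fin.forall_fin_succ]; exact ⟨hc₁, hc₂, hc₁, hc₂, nofun⟩)
      (fun Φ d p _ => HC.hasRightGDerivAt_frameMap_iff)
      (fun Φ d p _ h => HC.rightGDeriv_eq h1 h) hΦ.1 hΦ.2
    refine ⟨hn, F 0, F 1, F 2, F 3, hFa 0, hFa 1, hFa 2, hFa 3, fun ζ hζ => ⟨?_, ?_⟩⟩
    · rw [HC.coords_spec (Φ ζ)]
      simp only [(hF ζ hζ _).1]
      rfl
    · rw [HC.coords_spec (HC.rightGDeriv _ Φ ζ)]
      simp only [(hF ζ hζ _).2]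
      rfl
  · obtain ⟨hn, F, hFa, hF⟩ := HC.exists_analytic_coords P
      (φ := ![HC.f₁, HC.f₂, HC.f₂, HC.f₁])
      (by simp [Fin.forall_fin_succ, HC.continuous_f₁, HC.continuous_f₂])
      (by simp [Fin.forall_fin_succ, hs₁, hs₂]) hΩ_open
      (by simp only [Fin.forall_fin_succ]; exact ⟨hc₁, hc₂, hc₂, hc₁, nofun⟩)
      (fun Φ d p _ => HC.hasLeftGDerivAt_frameMap_iff)
      (fun Φ d p _ h => HC.leftGDeriv_eq h1 h) hΨ.1 hΨ.2
    refine ⟨hn, F 0, F 1, F 2, F 3, hFa 0, hFa 1, hFa 2, hFa 3, fun ζ hζ => ⟨?_, ?_⟩⟩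
    · rw [HC.coords_spec (Ψ ζ)]
      simp only [(hF ζ hζ _).1]
      rfl
    · rw [HC.coords_spec (HC.leftGDeriv _ Ψ ζ)]
      simp only [(hF ζ hζ _).2]
      rfl
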